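/- Let $M$ be a $C^\infty$, $d$-dimensional, compact connected Riemannian manifold without boundary, and let $\lambda$ be its Riemannian probability (the Riemannian volume normalized to total mass $1$). For an integer $k\ge 0$ let $C^k_{sym}(M\times M)$ denote the space of symmetric $C^k$ functions $V:M\times M\to\mathbb R$, $V(x,y)=V(y,x)$, with the topology of $C^k$ convergence. For a Borel probability measure $\mu$ on $M$ put $$V\mu(x)=\int_M V(x,y)\,\mu(dy),\qquad \Pi_V(\mu)(dx)=\frac{e^{-V\mu(x)}}{\int_M e^{-V\mu(y)}\lambda(dy)}\,\lambda(dx),$$ so that $\Pi_V$ maps Borel probability measures on $M$ to Borel probability measures on $M$. Every fixed point $\mu=\Pi_V(\mu)$ has a continuous density $f=d\mu/d\lambda$; $\mu$ is called nondegenerate if the only continuous function $u:M\to\mathbb R$ with $\int_M u\,d\lambda=0$ and $$u+f\cdot Vu-\Big(\int_M f\,(Vu)\,d\lambda\Big) f=0,\qquad Vu(x)=\int_M V(x,y)u(y)\,\lambda(dy),$$ is $u=0$. Theorem. For every integer $k\ge 0$, the set $\mathcal G$ of all $V\in C^k_{sym}(M\times M)$ such that every fixed point of $\Pi_V$ is nondegenerate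 is open and dense in $C^k_{sym}(M\times M)$. -/

import Mathlib

open MeasureTheory Set Topology
open scoped Manifold ContDiff

noncomputable section

namespace SelfInteracting

/-- The coordinate model space `ℝ^d` with its Euclidean norm and Lebesgue measure. -/
abbrev Coord (d : ℕ) : Type := EuclideanSpace ℝ (Fin d)

/-! ### Riemannian volume and the Riemannian probability -/

section Volume

variable {d : ℕ} {M : Type*} [TopologicalSpace M] [ChartedSpace (Coord d) M]
  [IsManifold (𝓡 d) ∞ M]

/-- A smooth Riemannian metric on the manifold `M`. -/
abbrev SmoothMetric (d : ℕ) (M : Type*) [TopologicalSpace M] [ChartedSpace (Coord d) M]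
    [IsManifold (𝓡 d) ∞ M] :=
  Bundle.ContMDiffRiemannianMetric (𝓡 d) ∞ (Coord d) (fun x : M => TangentSpace (𝓡 d) x)

/-- The `i`-th coordinate tangent vector, at the point with coordinates `y` in the chart
around `p`. -/
def coordVector (p : M) (y : Coord d) (i : Fin d) :
    TangentSpace (𝓡 d) ((extChartAt (𝓡 d) p).symm y) :=
  mfderiv 𝓘(ℝ, Coord d) (𝓡 d) (extChartAt (𝓡 d) p).symm y
    (EuclideanSpace.single i (1 : ℝ) : Coord d)

/-- The matrix `(g_ij)` of the metric in the chart around `p`, at coordinates `y`. -/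
def gramMatrix (g : SmoothMetric d M) (p : M) (y : Coord d) : Matrix (Fin d) (Fin d) ℝ :=
  Matrix.of fun i j => g.inner ((extChartAt (𝓡 d) p).symm y) (coordVector p y i)
    (coordVector p y j)

/-- Some smooth partition of unity subordinate to the charts of `M`. -/
def chartPartition (d : ℕ) (M : Type*) [TopologicalSpace M] [ChartedSpace (Coord d) M]
    [IsManifold (𝓡 d) ∞ M] [T2Space M] [CompactSpace M] :
    SmoothPartitionOfUnity M (𝓡 d) M univ :=
  (SmoothPartitionOfUnity.exists_isSubordinate_chartAt_source (𝓡 d) M).choose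

/-- The Riemannian volume `Σ_p ρ_p √(det g_ij) dy¹ ⋯ dy^d`, where `(ρ_p)` is a smooth partition
of unity subordinate to the charts; by the change of variables formula it depends neither on the
partition nor on the charts. -/
def riemannianVolume [T2Space M] [CompactSpace M] [MeasurableSpace M] (g : SmoothMetric d M) :
    Measure M :=
  Measure.sum fun p : M =>
    (((volume : Measure (Coord d)).restrict (extChartAt (𝓡 d) p).target).withDensity
      fun y => ENNReal.ofReal
        (chartPartition d M p ((extChartAt (𝓡 d) p).symm y) *
          Real.sqrt (gramMatrix g p y).det)).map (extChartAt (𝓡 d) p).symm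

/-- The Riemannian probability `λ`: the Riemannian volume divided by the total volume. -/
def riemannianProbability [T2Space M] [CompactSpace M] [MeasurableSpace M]
    (g : SmoothMetric d M) : Measure M :=
  (riemannianVolume g univ)⁻¹ • riemannianVolume g

end Volume

/-! ### The `C^k` topology and the space of symmetric `C^k` potentials -/

/-- The topology of `C^k` convergence on real functions on a manifold `N`: in each chart, uniform
convergence on the compact subsets of the chart domain of all derivatives of order at most `k`.
(It is only used on `C^k` functions on compact manifolds without boundary.) -/
@[reducible] def ckTopology {E : Type*} [NormedAddCommGroup E] [NormedSpace ℝ E] {H : Type*}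
    [TopologicalSpace H] (I : ModelWithCorners ℝ E H) (N : Type*) [TopologicalSpace N]
    [ChartedSpace H N] (k : ℕ) : TopologicalSpace (N → ℝ) :=
  ⨅ (p : N) (j : Fin (k + 1)),
    TopologicalSpace.induced
      (fun f : N → ℝ =>
        UniformOnFun.ofFun {K : Set E | IsCompact K ∧ K ⊆ (extChartAt I p).target}
          (iteratedFDeriv ℝ (j : ℕ) (f ∘ (extChartAt I p).symm)))
      inferInstance

/-- `C^k_sym(M × M)`: the symmetric functions `V : M × M → ℝ` of class `C^k`. -/
def CkSym (d k : ℕ) (M : Type*) [TopologicalSpace M] [ChartedSpace (Coord d) M] : Type _ :=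
  {V : M × M → ℝ // ContMDiff ((𝓡 d).prod (𝓡 d)) 𝓘(ℝ, ℝ) (k : WithTop ℕ∞) V ∧
    ∀ x y : M, V (x, y) = V (y, x)}

/-- `C^k_sym(M × M)` carries the topology of `C^k` convergence. -/
instance (d k : ℕ) (M : Type*) [TopologicalSpace M] [ChartedSpace (Coord d) M] :
    TopologicalSpace (CkSym d k M) :=
  TopologicalSpace.induced Subtype.val (ckTopology ((𝓡 d).prod (𝓡 d)) (M × M) k)

/-! ### The map `Π_V` and nondegeneracy of its fixed points

In this section `lam` is the reference probability `λ`. -/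

section FixedPoints

variable {M : Type*} [TopologicalSpace M] [MeasurableSpace M]

/-- `Vμ(x) = ∫ V(x,y) μ(dy)`. -/
def potential (V : M × M → ℝ) (μ : Measure M) (x : M) : ℝ :=
  ∫ y, V (x, y) ∂μ

/-- `Vu = V(uλ)`, that is `Vu(x) = ∫ V(x,y) u(y) λ(dy)`, for a function `u`. -/
def potentialFun (lam : Measure M) (V : M × M → ℝ) (u : M → ℝ) (x : M) : ℝ :=
  ∫ y, V (x, y) * u y ∂lam

/-- `ξ(f)(x) = e^{-f(x)} / ∫ e^{-f(y)} λ(dy)`. -/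
def xi (lam : Measure M) (f : M → ℝ) (x : M) : ℝ :=
  Real.exp (-f x) / ∫ y, Real.exp (-f y) ∂lam

/-- `Π_V(μ)(dx) = ξ(Vμ)(x) λ(dx)`. -/
def piMap (lam : Measure M) (V : M × M → ℝ) (μ : ProbabilityMeasure M) : Measure M :=
  lam.withDensity fun x => ENNReal.ofReal (xi lam (potential V (μ : Measure M)) x)

/-- `Fix(Π_V)`, the set of Borel probabilities `μ` with `μ = Π_V(μ)`. -/
def fixedPoints (lam : Measure M) (V : M × M → ℝ) : Set (ProbabilityMeasure M) :=
  {μ | (μ : Measure M) = piMap lam V μ}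

/-- `T(f)h = f h - ⟨f, h⟩_λ f`. -/
def opT (lam : Measure M) (f h : M → ℝ) (x : M) : ℝ :=
  f x * h x - (∫ y, f y * h y ∂lam) * f x

/-- The space of all continuous `u` with `∫ u dλ = 0` and `(Id + T(f) ∘ V)u = 0`. -/
def centerSpace (lam : Measure M) (V : M × M → ℝ) (f : M → ℝ) : Set (M → ℝ) :=
  {u | Continuous u ∧ ∫ x, u x ∂lam = 0 ∧
    ∀ x, u x + opT lam f (potentialFun lam V u) x = 0}

/-- A fixed point `μ` of `Π_V` is nondegenerate if, for its continuous density `f = dμ/dλ`, the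
space of continuous `u` with `∫ u dλ = 0` and `(Id + T(f) ∘ V)u = 0` reduces to zero. -/
def IsNondegenerate (lam : Measure M) (V : M × M → ℝ) (μ : ProbabilityMeasure M) : Prop :=
  ∃ f : M → ℝ, Continuous f ∧ (∀ x, 0 ≤ f x) ∧
    (μ : Measure M) = lam.withDensity (fun x => ENNReal.ofReal (f x)) ∧
    centerSpace lam V f = {0}

end FixedPoints

/-- The set `𝒢` of all `V ∈ C^k_sym(M × M)` such that every fixed point of `Π_V` is
nondegenerate, `λ` being the Riemannian probability of `g`. -/
def nondegeneratePotentials {d : ℕ} (k : ℕ) {M : Type*} [TopologicalSpace M]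
    [ChartedSpace (Coord d) M] [IsManifold (𝓡 d) ∞ M] [T2Space M] [CompactSpace M]
    [MeasurableSpace M] (g : SmoothMetric d M) : Set (CkSym d k M) :=
  {V | ∀ μ ∈ fixedPoints (riemannianProbability g) V.1,
    IsNondegenerate (riemannianProbability g) V.1 μ}

end SelfInteracting

end

/-! Put `h = Vμ`. Fixed points of `Π_V` correspond to continuous solutions of `h = V ξ(h)`, with `f
= ξ(h)` the density. The derivative of `ξ` at `h` is `-T(f)`, so the linearization is `Id + V T(f)`.
Its kernel is matched with that of `Id + T(f) V` by `v = Vu`, `u = -T(f)v`. Nondegeneracy thus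
becomes a condition on `C(M)` depending only on `V` as a continuous kernel
(`forall_isNondegenerate_iff`).

Openness is compactness. Gibbs densities have `L¹` norm 1 and `T(f)v` has `L¹` norm at most `2‖v‖`,
whatever `f` is, while integration against a continuous kernel sends `L¹`-bounded sets to relatively
compact ones. Hence degenerate solutions survive uniform limits of kernels, and `C^k` convergence is
stronger than uniform convergence.

Density comes from adding an external field `a(x) + a(y)`. Since `ξ` and `T(f)` ignore additive
constants, the new kernel is regular as soon as `a` is a regular value of `h ↦ h - V ξ(h)`
(`isRegularKernel_add_fieldKernel`). To find small such `a`, write `V` as a finite-rank kernel plus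
a remainder `R` with `‖R‖ ≤ 1/4`. The map `h ↦ h - R ξ(h)` is invertible, which reduces the question
to a map of a finite-dimensional space to itself (`ae_regularValue`). Sard's theorem in equal
dimensions needs only differentiability, so almost every field in the span of the first factors
works. These factors are smooth, so the perturbation is small in `C^k` for every `k`.

The geometry enters only through smooth partitions of unity and the fact that `λ` is a probability.
-/

noncomputable section

namespace SelfInteracting

/-! ### A finite-dimensional reduction of Sard's theorem -/

section Sard

variable {B : Type*} [NormedAddCommGroup B] [NormedSpace ℝ B] [CompleteSpace B]
  {E : Type*} [NormedAddCommGroup E] [NormedSpace ℝ E] [FiniteDimensional ℝ E]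
  [MeasurableSpace E] [BorelSpace E]

/-- A differentiable perturbation of the identity by a map with small derivative has a
differentiable global inverse. -/
theorem exists_differentiable_inverse {A : B → B} {A' : B → B →L[ℝ] B}
    (hA : ∀ h, HasFDerivAt A (A' h) h) (hA' : ∀ h, ‖A' h‖ ≤ 1 / 2) :
    ∃ (G : B → B) (G' : B → B →L[ℝ] B), (∀ h, G (h - A h) = h) ∧
      (∀ w, HasFDerivAt G (G' w) w) ∧ ∀ w v, G' w (v - A' (G w) v) = v := by
  have hlip : LipschitzWith (1 / 2) A := by
    refine lipschitzWith_of_nnnorm_fderiv_le (𝕜 := ℝ) (fun h => (hA h).differentiableAt)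
      fun h => ?_
    rw [(hA h).fderiv, ← NNReal.coe_le_coe]
    simpa using hA' h
  have happ : ApproximatesLinearOn (fun h => h - A h)
      ((ContinuousLinearEquiv.refl ℝ B : B ≃L[ℝ] B) : B →L[ℝ] B) univ (1 / 2) := by
    intro x _ y _
    have := hlip.dist_le_mul x y
    rw [dist_eq_norm, dist_eq_norm] at this
    have e : (x - A x - (y - A y) -
        ((ContinuousLinearEquiv.refl ℝ B : B ≃L[ℝ] B) : B →L[ℝ] B) (x - y)) = -(A x - A y) := by
      simp only [ContinuousLinearEquiv.coe_refl, ContinuousLinearMap.id_apply]; abel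
    rw [e, norm_neg]
    exact this
  -- The Lipschitz constant `1/2` must be less than `1 / ‖id‖ = 1`; in the zero space the identity
  -- has norm 0, hence the separate case.
  have hsub : Subsingleton B ∨ (1 / 2 : NNReal) <
      ‖((ContinuousLinearEquiv.refl ℝ B).symm : B →L[ℝ] B)‖₊⁻¹ := by
    rcases subsingleton_or_nontrivial B with h | h
    · exact Or.inl h
    · right
      have : ‖((ContinuousLinearEquiv.refl ℝ B).symm : B →L[ℝ] B)‖₊ = 1 := by
        rw [← NNReal.coe_inj]
        exact ContinuousLinearMap.norm_id
      rw [this, inv_one]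
      exact NNReal.half_lt_self one_ne_zero
  let Q : B ≃ₜ B := ApproximatesLinearOn.toHomeomorph _ happ hsub
  have hQ : ∀ h, Q h = h - A h := fun h => rfl
  have hlt : ∀ h, ‖A' h‖ < 1 := fun h => (hA' h).trans_lt (by norm_num)
  -- Neumann series: `‖A' h‖ < 1` makes `Id - A' h` invertible.
  let D : B → B ≃L[ℝ] B := fun h =>
    ContinuousLinearEquiv.unitsEquiv ℝ B (Units.oneSub (A' h) (hlt h))
  have hD : ∀ h v, D h v = v - A' h v := fun h v => rfl
  refine ⟨Q.symm, fun w => ((D (Q.symm w)).symm : B →L[ℝ] B), fun h => ?_, fun w => ?_,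
    fun w v => ?_⟩
  · rw [← hQ, Q.symm_apply_apply]
  · refine HasFDerivAt.of_local_left_inverse (f := Q) Q.symm.continuous.continuousAt ?_
      (Filter.Eventually.of_forall fun y => Q.apply_symm_apply y)
    exact (hasFDerivAt_id _).sub (hA _)
  · rw [← hD]
    exact (D (Q.symm w)).symm_apply_apply v

/-- Let `A` have small derivative, let `N` take values in a finite-dimensional space `E`, and let
`L : E → B` be linear. Then for almost all `t : E`, the value `L t` is regular for the map
`h ↦ h - A h - L (N h)`. -/
theorem ae_regularValue {A : B → B} {A' : B → B →L[ℝ] B}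
    (hA : ∀ h, HasFDerivAt A (A' h) h) (hA' : ∀ h, ‖A' h‖ ≤ 1 / 2) {N : B → E}
    {N' : B → B →L[ℝ] E} (hN : ∀ h, HasFDerivAt N (N' h) h) (L : E →L[ℝ] B)
    (ν : Measure E) [ν.IsAddHaarMeasure] :
    ∀ᵐ t ∂ν, ∀ h, h - A h - L (N h) = L t → ∀ v, v - A' h v - L (N' h v) = 0 → v = 0 := by
  obtain ⟨G, G', hG, hGd, hG'⟩ := exists_differentiable_inverse hA hA'
  -- The equation says `h - A h = L s` with `s = t + N h`, so `h = G (L s)` and `P s = t`.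
  -- Regularity of `L t` thus follows from regularity of `t` for `P`.
  let P : E → E := fun s => s - N (G (L s))
  let P' : E → E →L[ℝ] E := fun s =>
    ContinuousLinearMap.id ℝ E - (N' (G (L s))).comp ((G' (L s)).comp L)
  have hP : ∀ s, HasFDerivAt P (P' s) s := fun s =>
    (hasFDerivAt_id s).sub ((hN _).comp s ((hGd _).comp s L.hasFDerivAt))
  -- Equidimensional Sard: critical values of a merely differentiable map form a null set.
  have hnull : ν (P '' {s | (P' s).det = 0}) = 0 :=
    addHaar_image_eq_zero_of_det_fderivWithin_eq_zero ν
      (fun s _ => (hP s).hasFDerivWithinAt) (fun s hs => hs)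
  filter_upwards [measure_eq_zero_iff_ae_notMem.1 hnull] with t ht h hh v hv
  set s : E := t + N h with hs
  have hLs : L s = h - A h := by rw [hs, map_add, ← hh]; abel
  have hGs : G (L s) = h := by rw [hLs, hG]
  have hPs : P s = t := by
    change s - N (G (L s)) = t
    rw [hGs, hs, add_sub_cancel_right]
  have hdet : (P' s).det ≠ 0 := fun h0 => ht ⟨s, h0, hPs⟩
  have hv' : v - A' h v = L (N' h v) := sub_eq_zero.1 hv
  -- A kernel vector `v` is recovered from `N' h v`, which lies in the kernel of `P' s`;
  -- invertibility of `P' s` then kills both.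
  have hGL : G' (L s) (L (N' h v)) = v := by
    rw [← hv']; have := hG' (L s) v; rwa [hGs] at this
  have hker : P' s (N' h v) = 0 := by
    simp [P', hGs, hGL]
  have hzero : N' h v = 0 := by
    by_contra hne
    refine hdet ?_
    rw [ContinuousLinearMap.det]
    refine LinearMap.det_eq_zero_iff_ker_ne_bot.2 fun hb => hne ?_
    have : N' h v ∈ ((P' s : E →L[ℝ] E) : E →ₗ[ℝ] E).ker := hker
    rwa [hb, Submodule.mem_bot] at this
  rw [← hGL, hzero, map_zero, map_zero]

end Sard

/-! ### Kernel operators and the Gibbs map on the space of continuous functions -/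

section Operators

variable {X : Type*} [TopologicalSpace X] [CompactSpace X]

theorem abs_apply_le_norm (u : C(X, ℝ)) (x : X) : |u x| ≤ ‖u‖ := u.norm_coe_le_norm x

/-- The map `h ↦ e^{-h}` on continuous functions. -/
def expNeg (h : C(X, ℝ)) : C(X, ℝ) := NormedSpace.exp (-h)

theorem expNeg_apply (h : C(X, ℝ)) (x : X) : expNeg h x = Real.exp (-h x) := by
  have := NormedSpace.map_exp (ContinuousMap.evalAlgHom ℝ ℝ x)
    (continuous_eval_const x) (-h)
  rw [Real.exp_eq_exp_ℝ]
  exact this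

theorem hasFDerivAt_expNeg (h : C(X, ℝ)) :
    HasFDerivAt expNeg (-ContinuousLinearMap.mul ℝ C(X, ℝ) (expNeg h)) h := by
  have h1 : HasFDerivAt (NormedSpace.exp : C(X, ℝ) → C(X, ℝ))
    (NormedSpace.exp (-h) • (1 : C(X, ℝ) →L[ℝ] C(X, ℝ))) (-h) := hasFDerivAt_exp
  refine (h1.comp h (hasFDerivAt_id h).neg).congr_fderiv ?_
  ext v x
  simp [expNeg]

/-- The kernel `(x, y) ↦ a(x) + a(y)`. -/
def fieldKernel (a : C(X, ℝ)) : C(X × X, ℝ) :=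
  ⟨fun p => a p.1 + a p.2, by fun_prop⟩

variable [MeasurableSpace X] [BorelSpace X]

theorem integrable_continuousMap (μ : Measure X) [IsFiniteMeasure μ] (u : C(X, ℝ)) :
    Integrable u μ :=
  u.continuous.integrable_of_hasCompactSupport (HasCompactSupport.of_compactSpace _)

/-- Integration of continuous functions against a finite measure. -/
def integralCLM (μ : Measure X) [IsFiniteMeasure μ] : C(X, ℝ) →L[ℝ] ℝ :=
  LinearMap.mkContinuous
    { toFun := fun u => ∫ x, u x ∂μ
      map_add' := fun u v =>
        integral_add (integrable_continuousMap μ u) (integrable_continuousMap μ v)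
      map_smul' := fun c u => integral_const_mul c _ }
    (μ.real univ) fun u => by
      have := norm_integral_le_of_norm_le_const (μ := μ)
        (Filter.Eventually.of_forall fun x => u.norm_coe_le_norm x)
      rw [mul_comm] at this
      exact this

theorem integralCLM_apply (μ : Measure X) [IsFiniteMeasure μ] (u : C(X, ℝ)) :
    integralCLM μ u = ∫ x, u x ∂μ := rfl

theorem integralCLM_mono (μ : Measure X) [IsFiniteMeasure μ] {u v : C(X, ℝ)}
    (h : ∀ x, u x ≤ v x) : integralCLM μ u ≤ integralCLM μ v :=
  integral_mono (integrable_continuousMap μ u) (integrable_continuousMap μ v) h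

theorem integralCLM_one (μ : Measure X) [IsProbabilityMeasure μ] : integralCLM μ 1 = 1 := by
  simp [integralCLM_apply]

theorem integralCLM_algebraMap (μ : Measure X) [IsProbabilityMeasure μ] (c : ℝ) :
    integralCLM μ (c • 1) = c := by
  rw [map_smul, integralCLM_one, smul_eq_mul, mul_one]

/-- The continuous function `x ↦ ∫ V(x,y) μ(dy)`. -/
def potentialMap (μ : Measure X) [IsFiniteMeasure μ] (V : C(X × X, ℝ)) : C(X, ℝ) :=
  ⟨fun x => integralCLM μ (V.curry x), (integralCLM μ).continuous.comp V.curry.continuous⟩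

variable (lam : Measure X) [IsProbabilityMeasure lam]

theorem abs_integral_mul_le (w u : C(X, ℝ)) {ε : ℝ} (hw : ∀ y, |w y| ≤ ε) :
    |integralCLM lam (w * u)| ≤ ε * integralCLM lam |u| := by
  have h1 : |integralCLM lam (w * u)| ≤ integralCLM lam |w * u| := abs_integral_le_integral_abs
  refine h1.trans ?_
  rw [← smul_eq_mul ε, ← map_smul]
  refine integralCLM_mono lam fun y => ?_
  simp only [ContinuousMap.coe_abs, Pi.abs_apply, ContinuousMap.mul_apply, ContinuousMap.smul_apply,
    smul_eq_mul, abs_mul]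
  exact mul_le_mul_of_nonneg_right (hw y) (abs_nonneg _)

theorem integral_abs_le_norm (u : C(X, ℝ)) : integralCLM lam |u| ≤ ‖u‖ := by
  rw [← integralCLM_algebraMap lam ‖u‖]
  refine integralCLM_mono lam fun x => ?_
  simpa using abs_apply_le_norm u x

/-- The operator `u ↦ Vu`, `Vu(x) = ∫ V(x,y) u(y) λ(dy)`, on continuous functions. -/
def kernelOp (V : C(X × X, ℝ)) : C(X, ℝ) →L[ℝ] C(X, ℝ) :=
  LinearMap.mkContinuous
    { toFun := fun u =>
        ⟨fun x => integralCLM lam (V.curry x * u),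
          (integralCLM lam).continuous.comp (V.curry.continuous.mul continuous_const)⟩
      map_add' := fun u v => by ext x; simp [mul_add]
      map_smul' := fun c u => by ext x; simp }
    ‖V‖ fun u => by
      refine (ContinuousMap.norm_le _ (by positivity)).2 fun x => ?_
      exact (abs_integral_mul_le lam (V.curry x) u fun y => V.norm_coe_le_norm (x, y)).trans
        (mul_le_mul_of_nonneg_left (integral_abs_le_norm lam u) (norm_nonneg _))

theorem kernelOp_apply (V : C(X × X, ℝ)) (u : C(X, ℝ)) (x : X) :
    kernelOp lam V u x = ∫ y, V (x, y) * u y ∂lam := rfl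

theorem kernelOp_apply' (V : C(X × X, ℝ)) (u : C(X, ℝ)) (x : X) :
    kernelOp lam V u x = integralCLM lam (V.curry x * u) := rfl

theorem kernelOp_add (V W : C(X × X, ℝ)) (u : C(X, ℝ)) :
    kernelOp lam (V + W) u = kernelOp lam V u + kernelOp lam W u := by
  ext x
  rw [ContinuousMap.add_apply, kernelOp_apply', kernelOp_apply', kernelOp_apply', ← map_add,
    ← add_mul]
  rfl

theorem kernelOp_sub (V W : C(X × X, ℝ)) (u : C(X, ℝ)) :
    kernelOp lam (V - W) u = kernelOp lam V u - kernelOp lam W u := by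
  rw [eq_sub_iff_add_eq, ← kernelOp_add, sub_add_cancel]

/-- The `L¹` norm of `u` is essential: Gibbs densities have no uniform sup bound. -/
theorem norm_kernelOp_le (V : C(X × X, ℝ)) (u : C(X, ℝ)) :
    ‖kernelOp lam V u‖ ≤ ‖V‖ * integralCLM lam |u| := by
  have h0 : 0 ≤ integralCLM lam |u| := by
    rw [← map_zero (integralCLM lam)]
    exact integralCLM_mono lam fun x => by simp
  refine (ContinuousMap.norm_le _ (by positivity)).2 fun x => ?_
  exact abs_integral_mul_le lam (V.curry x) u fun y => V.norm_coe_le_norm (x, y)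

/-- The operator `T(f)h = f h - ⟨f, h⟩ f`. -/
def tangentOp (f : C(X, ℝ)) : C(X, ℝ) →L[ℝ] C(X, ℝ) :=
  ContinuousLinearMap.mul ℝ C(X, ℝ) f -
    ((integralCLM lam).comp (ContinuousLinearMap.mul ℝ C(X, ℝ) f)).smulRight f

theorem tangentOp_apply (f v : C(X, ℝ)) :
    tangentOp lam f v = f * v - integralCLM lam (f * v) • f := rfl

theorem continuous_tangentOp : Continuous fun p : C(X, ℝ) × C(X, ℝ) => tangentOp lam p.1 p.2 := by
  simp only [tangentOp_apply]
  fun_prop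

theorem coe_tangentOp (f v : C(X, ℝ)) : ⇑(tangentOp lam f v) = opT lam f v := rfl

theorem tangentOp_add_const (f v : C(X, ℝ)) (hf : integralCLM lam f = 1) (c : ℝ) :
    tangentOp lam f (v + c • 1) = tangentOp lam f v := by
  have : tangentOp lam f (c • 1) = 0 := by
    rw [tangentOp_apply, mul_smul_comm, mul_one, map_smul, hf, smul_eq_mul, mul_one, sub_self]
  rw [map_add, this, add_zero]

theorem integral_tangentOp (f v : C(X, ℝ)) (hf : integralCLM lam f = 1) :
    integralCLM lam (tangentOp lam f v) = 0 := by
  rw [tangentOp_apply, map_sub, map_smul, hf, smul_eq_mul, mul_one, sub_self]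

/-- `T(f)v` is `(v - ⟨f, v⟩) f`, where the first factor is at most `2‖v‖` and `f` is a probability
density. The bound is therefore uniform in `f`. -/
theorem integral_abs_tangentOp_le (f v : C(X, ℝ)) (hf0 : ∀ x, 0 ≤ f x)
    (hf : integralCLM lam f = 1) : integralCLM lam |tangentOp lam f v| ≤ 2 * ‖v‖ := by
  have h1 : |integralCLM lam (f * v)| ≤ ‖v‖ := by
    have := abs_integral_mul_le lam v f (abs_apply_le_norm v)
    have habs : |f| = f := by ext x; simp [abs_of_nonneg (hf0 x)]
    rwa [habs, hf, mul_one, mul_comm] at this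
  have h2 : integralCLM lam |tangentOp lam f v| ≤ integralCLM lam ((2 * ‖v‖) • f) := by
    refine integralCLM_mono lam fun x => ?_
    rw [tangentOp_apply]
    simp only [ContinuousMap.coe_abs, Pi.abs_apply, ContinuousMap.sub_apply,
      ContinuousMap.mul_apply, ContinuousMap.smul_apply, smul_eq_mul]
    have e : f x * v x - integralCLM lam (f * v) * f x =
      (v x - integralCLM lam (f * v)) * f x := by ring
    rw [e, abs_mul, abs_of_nonneg (hf0 x)]
    refine mul_le_mul_of_nonneg_right ?_ (hf0 x)
    have := abs_sub (v x) (integralCLM lam (f * v))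
    linarith [abs_apply_le_norm v x]
  rwa [map_smul, hf, smul_eq_mul, mul_one] at h2

theorem integral_expNeg_pos (h : C(X, ℝ)) : 0 < integralCLM lam (expNeg h) := by
  have : integralCLM lam (Real.exp (-‖h‖) • 1) ≤ integralCLM lam (expNeg h) := by
    refine integralCLM_mono lam fun x => ?_
    rw [expNeg_apply]
    simpa using (le_abs_self _).trans (abs_apply_le_norm h x)
  rw [integralCLM_algebraMap] at this
  exact (Real.exp_pos _).trans_le this

/-- The Gibbs density `ξ(h) = e^{-h} / ∫ e^{-h} dλ`, as a continuous function. -/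
def gibbs (h : C(X, ℝ)) : C(X, ℝ) := (integralCLM lam (expNeg h))⁻¹ • expNeg h

theorem coe_gibbs (h : C(X, ℝ)) : ⇑(gibbs lam h) = xi lam h := by
  ext x
  rw [gibbs, xi, ContinuousMap.smul_apply, smul_eq_mul, expNeg_apply, div_eq_inv_mul,
    integralCLM_apply]
  simp only [expNeg_apply]

theorem gibbs_nonneg (h : C(X, ℝ)) (x : X) : 0 ≤ gibbs lam h x := by
  rw [gibbs, ContinuousMap.smul_apply, smul_eq_mul, expNeg_apply]
  have := integral_expNeg_pos lam h
  positivity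

theorem integral_gibbs (h : C(X, ℝ)) : integralCLM lam (gibbs lam h) = 1 := by
  rw [gibbs, map_smul, smul_eq_mul, inv_mul_cancel₀ (integral_expNeg_pos lam h).ne']

theorem gibbs_add_const (h : C(X, ℝ)) (c : ℝ) : gibbs lam (h + c • 1) = gibbs lam h := by
  have : expNeg (h + c • 1) = Real.exp (-c) • expNeg h := by
    ext x
    simp [expNeg_apply, ← Real.exp_add, add_comm]
  rw [gibbs, this, map_smul, smul_smul, gibbs, smul_eq_mul, mul_inv, mul_comm _⁻¹, mul_assoc,
    inv_mul_cancel₀ (Real.exp_pos _).ne', mul_one]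

theorem hasFDerivAt_gibbs (h : C(X, ℝ)) :
    HasFDerivAt (gibbs lam) (-tangentOp lam (gibbs lam h)) h := by
  have h0 := (integral_expNeg_pos lam h).ne'
  have h1 := hasFDerivAt_expNeg h
  have h2 := (integralCLM lam).hasFDerivAt.comp h h1
  have h3 := (hasDerivAt_inv h0).comp_hasFDerivAt h h2
  refine (h3.smul h1).congr_fderiv ?_
  ext v x
  simp [tangentOp_apply, gibbs]
  field_simp
  ring

theorem continuous_gibbs : Continuous (gibbs lam) :=
  continuous_iff_continuousAt.2 fun h => (hasFDerivAt_gibbs lam h).continuousAt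

end Operators

/-! ### Regular kernels -/

section Regular

theorem integral_withDensity_ofReal {X : Type*} [TopologicalSpace X] [MeasurableSpace X]
    [OpensMeasurableSpace X] (lam : Measure X) {f : C(X, ℝ)} (hf : ∀ x, 0 ≤ f x) (u : X → ℝ) :
    ∫ y, u y ∂lam.withDensity (fun x => ENNReal.ofReal (f x)) = ∫ y, u y * f y ∂lam := by
  rw [integral_withDensity_eq_integral_toReal_smul
    (f := fun x => ENNReal.ofReal (f x))
    (ENNReal.measurable_ofReal.comp f.continuous.measurable)
    (Filter.Eventually.of_forall fun x => ENNReal.ofReal_lt_top)]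
  refine integral_congr_ae (Filter.Eventually.of_forall fun x => ?_)
  simp only [smul_eq_mul, ENNReal.toReal_ofReal (hf x)]
  exact mul_comm _ _

variable {X : Type*} [TopologicalSpace X] [CompactSpace X] [MeasurableSpace X] [BorelSpace X]
  (lam : Measure X) [IsProbabilityMeasure lam]

/-- `V` is regular if every solution `h` of `h = V ξ(h)` is nondegenerate, in the sense that the
derivative of `h ↦ h - V ξ(h)` there is injective. -/
def IsRegularKernel (V : C(X × X, ℝ)) : Prop :=
  ∀ h, kernelOp lam V (gibbs lam h) = h →
    ∀ v, v + kernelOp lam V (tangentOp lam (gibbs lam h) v) = 0 → v = 0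

theorem lintegral_ofReal_eq {f : C(X, ℝ)} (hf : ∀ x, 0 ≤ f x) :
    ∫⁻ x, ENNReal.ofReal (f x) ∂lam = ENNReal.ofReal (integralCLM lam f) :=
  (ofReal_integral_eq_lintegral_ofReal (integrable_continuousMap lam f)
    (Filter.Eventually.of_forall hf)).symm

theorem potentialFun_eq_kernelOp (V : C(X × X, ℝ)) (u : C(X, ℝ)) :
    potentialFun lam V u = kernelOp lam V u := rfl

/-- All fixed points of `Π_V` are nondegenerate if and only if `V` is a regular kernel. -/
theorem forall_isNondegenerate_iff (V : C(X × X, ℝ)) :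
    (∀ μ ∈ fixedPoints lam V, IsNondegenerate lam V μ) ↔ IsRegularKernel lam V := by
  constructor
  · intro H h hh v hv
    set f := gibbs lam h with hf
    have hf0 : ∀ x, 0 ≤ f x := gibbs_nonneg lam h
    have hprob : IsProbabilityMeasure (lam.withDensity fun x => ENNReal.ofReal (f x)) := by
      constructor
      rw [withDensity_apply _ MeasurableSet.univ, setLIntegral_univ, lintegral_ofReal_eq lam hf0,
        hf, integral_gibbs, ENNReal.ofReal_one]
    let μ : ProbabilityMeasure X := ⟨_, hprob⟩
    have hpot : potential V (μ : Measure X) = h := by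
      ext x
      rw [← hh]
      exact integral_withDensity_ofReal lam hf0 _
    have hμ : μ ∈ fixedPoints lam V := by
      change (lam.withDensity fun x => ENNReal.ofReal (f x)) = piMap lam V μ
      rw [piMap, hpot, ← coe_gibbs]
    obtain ⟨f', hf'c, hf'0, hμf', hcenter⟩ := H μ hμ
    lift f' to C(X, ℝ) using hf'c
    -- As `λ` may lack full support here, the given continuous density agrees with the Gibbs density
    -- only almost everywhere; the operator `V` does not see the difference.
    have hae : f =ᵐ[lam] f' := by
      have := (withDensity_eq_iff
        (ENNReal.measurable_ofReal.comp f.continuous.measurable).aemeasurable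
        (ENNReal.measurable_ofReal.comp f'.continuous.measurable).aemeasurable
        (by change ∫⁻ x, ENNReal.ofReal (f x) ∂lam ≠ _
            rw [lintegral_ofReal_eq lam hf0]; exact ENNReal.ofReal_ne_top)).1 hμf'
      filter_upwards [this] with x hx
      exact (ENNReal.ofReal_eq_ofReal_iff (hf0 x) (hf'0 x)).1 hx
    have hf'1 : integralCLM lam f' = 1 := by
      rw [← integral_gibbs lam h]
      exact (integral_congr_ae hae).symm
    have hK : ∀ w, kernelOp lam V (tangentOp lam f w) = kernelOp lam V (tangentOp lam f' w) := by
      intro w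
      have hI : integralCLM lam (f * w) = integralCLM lam (f' * w) :=
        integral_congr_ae (by filter_upwards [hae] with x hx; simp [hx])
      ext x
      refine integral_congr_ae ?_
      filter_upwards [hae] with y hy
      simp [tangentOp_apply, hI, hy]
    have hKv : kernelOp lam V (-tangentOp lam f' v) = v := by
      rw [map_neg, ← hK, ← eq_neg_of_add_eq_zero_left hv]
    -- With `u = -T(f')v` one has `Vu = v`, so `u + T(f')Vu = 0`.
    have hmem : ⇑(-tangentOp lam f' v) ∈ centerSpace lam V f' := by
      refine ⟨ContinuousMap.continuous _, ?_, fun x => ?_⟩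
      · change integralCLM lam (-tangentOp lam f' v) = 0
        rw [map_neg, integral_tangentOp lam f' v hf'1, neg_zero]
      · rw [potentialFun_eq_kernelOp, hKv, ← coe_tangentOp]
        simp
    rw [hcenter, mem_singleton_iff] at hmem
    have : -tangentOp lam f' v = 0 := DFunLike.coe_injective hmem
    rw [← hKv, this, map_zero]
  · intro H μ hμ
    obtain ⟨h, hpot⟩ : ∃ h : C(X, ℝ), potential V (μ : Measure X) = h :=
      ⟨potentialMap (μ : Measure X) V, rfl⟩
    have hf0 : ∀ x, 0 ≤ gibbs lam h x := gibbs_nonneg lam h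
    have hμ' : (μ : Measure X) = lam.withDensity fun x => ENNReal.ofReal (gibbs lam h x) := by
      have : (μ : Measure X) = piMap lam V μ := hμ
      rwa [piMap, hpot, ← coe_gibbs] at this
    have hfix : kernelOp lam V (gibbs lam h) = h := by
      ext x
      rw [← hpot, potential, hμ', integral_withDensity_ofReal lam hf0]
      rfl
    refine ⟨gibbs lam h, ContinuousMap.continuous _, hf0, hμ', ?_⟩
    refine eq_singleton_iff_unique_mem.2 ⟨⟨continuous_zero, by simp, fun x => ?_⟩, ?_⟩
    · have : potentialFun lam V 0 = ⇑(0 : C(X, ℝ)) := by ext; simp [potentialFun]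
      rw [this, ← coe_tangentOp, map_zero]
      simp
    · rintro u ⟨hu, -, hu0⟩
      lift u to C(X, ℝ) using hu
      rw [potentialFun_eq_kernelOp, ← coe_tangentOp] at hu0
      have hu1 : u + tangentOp lam (gibbs lam h) (kernelOp lam V u) = 0 :=
        ContinuousMap.ext hu0
      have hv := H h hfix (kernelOp lam V u) (by rw [← map_add, hu1, map_zero])
      rw [hv, map_zero, add_zero] at hu1
      rw [hu1, ContinuousMap.coe_zero]

/-! ### Openness -/

/-- Arzelà–Ascoli: `x ↦ V(x, ·)` is continuous in sup norm, which gives a modulus of continuity for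
`Vu` depending on `u` only through its `L¹` bound. -/
theorem exists_tendsto_kernelOp (V : C(X × X, ℝ)) {C : ℝ} {u : ℕ → C(X, ℝ)}
    (hu : ∀ n, integralCLM lam |u n| ≤ C) : ∃ (w : C(X, ℝ)) (φ : ℕ → ℕ), StrictMono φ ∧
      Filter.Tendsto (fun n => kernelOp lam V (u (φ n))) Filter.atTop (𝓝 w) := by
  let e := ContinuousMap.isometryEquivBoundedOfCompact X ℝ
  let A : Set (BoundedContinuousFunction X ℝ) := range fun n => e (kernelOp lam V (u n))
  have hA : IsCompact (closure A) := by
    refine BoundedContinuousFunction.arzela_ascoli (Metric.closedBall 0 (‖V‖ * C))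
      (isCompact_closedBall _ _) A ?_ fun x₀ => ?_
    · rintro _ x ⟨n, rfl⟩
      rw [mem_closedBall_zero_iff]
      exact (((kernelOp lam V (u n)).norm_coe_le_norm x).trans (norm_kernelOp_le lam V _)).trans
        (mul_le_mul_of_nonneg_left (hu n) (norm_nonneg _))
    · refine Metric.equicontinuousAt_of_continuity_modulus
        (fun x => ‖V.curry x₀ - V.curry x‖ * C) ?_ _ (Filter.Eventually.of_forall ?_)
      · have : Continuous fun x => ‖V.curry x₀ - V.curry x‖ * C :=
          ((continuous_const.sub V.curry.continuous).norm).mul continuous_const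
        simpa using this.tendsto x₀
      · rintro x ⟨_, n, rfl⟩
        change dist (kernelOp lam V (u n) x₀) (kernelOp lam V (u n) x) ≤ _
        rw [Real.dist_eq, kernelOp_apply', kernelOp_apply', ← map_sub, ← sub_mul]
        exact (abs_integral_mul_le lam _ (u n)
          fun y => abs_apply_le_norm (V.curry x₀ - V.curry x) y).trans
          (mul_le_mul_of_nonneg_left (hu n) (norm_nonneg _))
  obtain ⟨w, -, φ, hφ, hlim⟩ := hA.tendsto_subseq
    (x := fun n => e (kernelOp lam V (u n))) fun n => subset_closure ⟨n, rfl⟩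
  refine ⟨e.symm w, φ, hφ, ?_⟩
  have := (e.symm.continuous.tendsto w).comp hlim
  refine this.congr fun n => ?_
  simp

theorem exists_tendsto_kernelOp_of_tendsto {V : ℕ → C(X × X, ℝ)} {W : C(X × X, ℝ)}
    (hV : Filter.Tendsto V Filter.atTop (𝓝 W)) {C : ℝ} {u : ℕ → C(X, ℝ)}
    (hu : ∀ n, integralCLM lam |u n| ≤ C) : ∃ (w : C(X, ℝ)) (φ : ℕ → ℕ), StrictMono φ ∧
      Filter.Tendsto (fun n => kernelOp lam (V (φ n)) (u (φ n))) Filter.atTop (𝓝 w) := by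
  obtain ⟨w, φ, hφ, hw⟩ := exists_tendsto_kernelOp lam W hu
  refine ⟨w, φ, hφ, ?_⟩
  have h0 : Filter.Tendsto (fun n => kernelOp lam (V (φ n) - W) (u (φ n))) Filter.atTop
      (𝓝 0) := by
    refine squeeze_zero_norm (a := fun n => ‖V (φ n) - W‖ * C) (fun n => ?_) ?_
    · exact (norm_kernelOp_le lam _ _).trans (mul_le_mul_of_nonneg_left (hu _) (norm_nonneg _))
    · have := (((hV.comp hφ.tendsto_atTop).sub_const W).norm).mul_const C
      simpa using this
  have := hw.add h0
  rw [add_zero] at this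
  refine this.congr fun n => ?_
  rw [kernelOp_sub, add_sub_cancel]

theorem continuous_kernelOp :
    Continuous fun p : C(X × X, ℝ) × C(X, ℝ) => kernelOp lam p.1 p.2 := by
  let K : C(X × X, ℝ) →ₗ[ℝ] C(X, ℝ) →ₗ[ℝ] C(X, ℝ) :=
    LinearMap.mk₂ ℝ (fun V u => kernelOp lam V u) (kernelOp_add lam)
      (fun c V u => by
        ext x
        simp only [kernelOp_apply, ContinuousMap.smul_apply, smul_eq_mul, mul_assoc]
        exact integral_const_mul _ _)
      (fun V u v => map_add _ _ _) (fun c V u => map_smul _ _ _)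
  exact (K.mkContinuous₂ 1 fun V u => by
    rw [one_mul]
    exact (norm_kernelOp_le lam V u).trans
      (mul_le_mul_of_nonneg_left (integral_abs_le_norm lam u) (norm_nonneg _))).continuous₂

/-- Regular kernels form an open set for uniform convergence. -/
theorem isOpen_isRegularKernel : IsOpen {V : C(X × X, ℝ) | IsRegularKernel lam V} := by
  rw [← isClosed_compl_iff]
  refine IsSeqClosed.isClosed fun V W hV hVW => ?_
  have hbad : ∀ n, ∃ h, kernelOp lam (V n) (gibbs lam h) = h ∧ ∃ v : C(X, ℝ), ‖v‖ = 1 ∧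
      v + kernelOp lam (V n) (tangentOp lam (gibbs lam h) v) = 0 := by
    intro n
    have : ¬ IsRegularKernel lam (V n) := hV n
    simp only [IsRegularKernel, not_forall] at this
    obtain ⟨h, hh, v, hv, hv0⟩ := this
    refine ⟨h, hh, ‖v‖⁻¹ • v, norm_smul_inv_norm hv0, ?_⟩
    rw [map_smul, map_smul, ← smul_add, hv, smul_zero]
  choose h hh v hv1 hv using hbad
  -- Since `h n` is itself the image of a Gibbs density, compactness yields a convergent subsequence
  -- of the solutions.
  obtain ⟨h', φ, hφ, hlim⟩ := exists_tendsto_kernelOp_of_tendsto lam hVW (C := 1)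
    (u := fun n => gibbs lam (h n)) fun n => by
      have : |gibbs lam (h n)| = gibbs lam (h n) := by
        ext x; simp [abs_of_nonneg (gibbs_nonneg lam (h n) x)]
      rw [this, integral_gibbs]
  simp only [hh] at hlim
  obtain ⟨v', θ, hθ, hlimv⟩ := exists_tendsto_kernelOp_of_tendsto lam
    (hVW.comp hφ.tendsto_atTop) (C := 2)
    (u := fun n => tangentOp lam (gibbs lam (h (φ n))) (v (φ n))) fun n => by
      have := integral_abs_tangentOp_le lam (gibbs lam (h (φ n))) (v (φ n))
        (gibbs_nonneg lam _) (integral_gibbs lam _)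
      rwa [hv1, mul_one] at this
  -- The kernel vectors are images under `-V` of `L¹`-bounded functions, so they converge in norm
  -- and the limit still has norm 1.
  have hvlim : Filter.Tendsto (fun n => v (φ (θ n))) Filter.atTop (𝓝 (-v')) := by
    refine hlimv.neg.congr fun n => ?_
    exact (eq_neg_of_add_eq_zero_left (hv (φ (θ n)))).symm
  have hhlim := hlim.comp hθ.tendsto_atTop
  have hVlim := hVW.comp (hφ.tendsto_atTop.comp hθ.tendsto_atTop)
  have hglim := ((continuous_gibbs lam).tendsto h').comp hhlim
  intro hW
  have hne : -v' ≠ 0 := by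
    intro h0
    have := tendsto_nhds_unique hvlim.norm (tendsto_const_nhds.congr fun n => (hv1 _).symm)
    rw [h0, norm_zero] at this
    exact zero_ne_one this
  refine hne (hW h' ?_ (-v') ?_)
  · refine tendsto_nhds_unique
      (((continuous_kernelOp lam).tendsto (W, gibbs lam h')).comp (hVlim.prodMk_nhds hglim)) ?_
    exact hhlim.congr fun n => (hh _).symm
  · have htlim := ((continuous_tangentOp lam).tendsto (gibbs lam h', -v')).comp
      (hglim.prodMk_nhds hvlim)
    refine tendsto_nhds_unique (hvlim.add
      (((continuous_kernelOp lam).tendsto (W, tangentOp lam (gibbs lam h') (-v'))).comp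
        (hVlim.prodMk_nhds htlim))) ?_
    exact tendsto_const_nhds.congr fun n => (hv _).symm

/-! ### Density -/

theorem kernelOp_fieldKernel (a u : C(X, ℝ)) :
    kernelOp lam (fieldKernel a) u = integralCLM lam u • a + integralCLM lam (a * u) • 1 := by
  ext x
  have : (fieldKernel a).curry x = a x • 1 + a := by ext y; simp [fieldKernel]
  rw [kernelOp_apply', this, add_mul, smul_mul_assoc, one_mul, map_add, map_smul]
  simp [mul_comm]

/-- The field contributes `a` plus a constant to the fixed-point equation, and only a constant to
its linearization because `T(f)v` has mean zero. Shifting `h` and `v` by these constants gives the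
hypothesis for `V` and the value `a`. -/
theorem isRegularKernel_add_fieldKernel {V : C(X × X, ℝ)} {a : C(X, ℝ)}
    (H : ∀ h, h - kernelOp lam V (gibbs lam h) = a →
      ∀ v, v + kernelOp lam V (tangentOp lam (gibbs lam h) v) = 0 → v = 0) :
    IsRegularKernel lam (V + fieldKernel a) := by
  intro h hh v hv
  set f := gibbs lam h with hf
  rw [kernelOp_add, kernelOp_fieldKernel, integral_gibbs, one_smul] at hh
  rw [kernelOp_add, kernelOp_fieldKernel, integral_tangentOp lam f v (integral_gibbs lam h),
    zero_smul, zero_add] at hv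
  set b := integralCLM lam (a * f)
  set c := integralCLM lam (a * tangentOp lam f v)
  have hfb : gibbs lam (h + (-b) • 1) = f := gibbs_add_const lam h _
  have ht : tangentOp lam f (v + c • 1) = tangentOp lam f v :=
    tangentOp_add_const lam f v (integral_gibbs lam h) c
  have h0 := H (h + (-b) • 1) (by
    rw [hfb]
    conv_lhs => rw [← hh]
    rw [neg_smul]; abel) (v + c • 1) (by rw [hfb, ht, ← hv]; abel)
  -- So far `v` is only the constant `-c`; as `T(f)` kills constants, `c` vanishes too.
  have htv : tangentOp lam f v = 0 := by rw [← ht, h0, map_zero]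
  have hc : c = 0 := by simp only [c, htv, mul_zero, map_zero]
  rwa [hc, zero_smul, add_zero] at h0

/-- If `V` is close to the finite-rank kernel `∑ φ_i ⊗ ψ_i`, then perturbing `V` by the external
field `∑ t_i φ_i` makes it regular for almost all `t`. -/
theorem ae_isRegularKernel {ι : Type*} [Fintype ι] (V : C(X × X, ℝ)) (φ ψ : ι → C(X, ℝ))
    (hV : ∀ x y, |V (x, y) - ∑ i, φ i x * ψ i y| ≤ 1 / 4) :
    ∀ᵐ t : ι → ℝ, IsRegularKernel lam (V + fieldKernel (∑ i, t i • φ i)) := by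
  let L : (ι → ℝ) →L[ℝ] C(X, ℝ) :=
    ∑ i, (ContinuousLinearMap.proj (R := ℝ) (φ := fun _ : ι => ℝ) i).smulRight (φ i)
  have hL : ∀ t, L t = ∑ i, t i • φ i := fun t => by simp [L]
  let Ψ : C(X, ℝ) →L[ℝ] (ι → ℝ) :=
    ContinuousLinearMap.pi fun i => (integralCLM lam).comp (ContinuousLinearMap.mul ℝ _ (ψ i))
  let F : C(X × X, ℝ) := ⟨fun p => ∑ i, φ i p.1 * ψ i p.2, by fun_prop⟩
  have hF : ∀ u, kernelOp lam F u = L (Ψ u) := by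
    intro u
    ext x
    have : F.curry x = ∑ i, φ i x • ψ i := by ext y; simp [F]
    rw [kernelOp_apply', this, Finset.sum_mul, map_sum, hL]
    simp [Ψ, mul_comm]
  let R : C(X × X, ℝ) := V - F
  have hR : ‖R‖ ≤ 1 / 4 := (ContinuousMap.norm_le _ (by norm_num)).2 fun p => hV p.1 p.2
  have hVR : ∀ u, kernelOp lam V u = kernelOp lam R u + L (Ψ u) := fun u => by
    rw [← hF, kernelOp_sub, sub_add_cancel]
  have key := ae_regularValue
    (A := fun h => kernelOp lam R (gibbs lam h))
    (A' := fun h => (kernelOp lam R).comp (-tangentOp lam (gibbs lam h)))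
    (fun h => (kernelOp lam R).hasFDerivAt.comp h (hasFDerivAt_gibbs lam h))
    (fun h => ContinuousLinearMap.opNorm_le_bound _ (by norm_num) fun v => by
      rw [ContinuousLinearMap.comp_apply, neg_apply, map_neg, norm_neg]
      have h1 := norm_kernelOp_le lam R (tangentOp lam (gibbs lam h) v)
      have h2 := integral_abs_tangentOp_le lam (gibbs lam h) v (gibbs_nonneg lam h)
        (integral_gibbs lam h)
      -- The closeness `1/4` times the factor 2 from the bound on `T(f)` gives the contraction
      -- constant `1/2`.
      have h3 : ‖R‖ * integralCLM lam |tangentOp lam (gibbs lam h) v| ≤ 1 / 4 * (2 * ‖v‖) :=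
        (mul_le_mul_of_nonneg_left h2 (norm_nonneg _)).trans
          (mul_le_mul_of_nonneg_right hR (by positivity))
      linarith)
    (N := fun h => Ψ (gibbs lam h)) (N' := fun h => Ψ.comp (-tangentOp lam (gibbs lam h)))
    (fun h => Ψ.hasFDerivAt.comp h (hasFDerivAt_gibbs lam h)) L (volume : Measure (ι → ℝ))
  filter_upwards [key] with t ht
  rw [← hL]
  refine isRegularKernel_add_fieldKernel lam fun h hh v hv => ht h ?_ v ?_
  · rw [← hh, hVR, sub_add_eq_sub_sub]
  · simp only [ContinuousLinearMap.comp_apply, neg_apply, map_neg,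
      sub_neg_eq_add]
    rw [← hv, hVR, add_assoc]

end Regular

/-! ### The topology of `C^k` convergence -/

section CkTopology

variable {E : Type*} [NormedAddCommGroup E] [NormedSpace ℝ E] {H : Type*}
  [TopologicalSpace H] (I : ModelWithCorners ℝ E H) (N : Type*) [TopologicalSpace N]
  [ChartedSpace H N] (k : ℕ)

theorem continuous_iteratedFDeriv_ckTopology (p : N) (j : Fin (k + 1)) :
    Continuous[ckTopology I N k, inferInstance] (fun f : N → ℝ =>
      UniformOnFun.ofFun {K : Set E | IsCompact K ∧ K ⊆ (extChartAt I p).target}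
        (iteratedFDeriv ℝ (j : ℕ) (f ∘ (extChartAt I p).symm))) :=
  continuous_iInf_dom (i := p) (continuous_iInf_dom (i := j) continuous_induced_dom)

variable {I N k}

/-- `C^k` convergence implies locally uniform convergence. -/
theorem tendstoLocallyUniformly_of_tendsto_ckTopology [I.Boundaryless] [LocallyCompactSpace E]
    {α : Type*} {l : Filter α} {F : α → N → ℝ} {f : N → ℝ}
    (hF : Filter.Tendsto F l (@nhds _ (ckTopology I N k) f)) :
    TendstoLocallyUniformly F f l := by
  rw [← tendstoLocallyUniformlyOn_univ]
  refine tendstoLocallyUniformlyOn_of_forall_exists_nhds ?_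
  intro p _
  obtain ⟨K, hK, hKt, hKc⟩ := local_compact_nhds (extChartAt_target_mem_nhds (I := I) p)
  -- The derivative of order `j = 0` suffices.
  have h1 := (@Continuous.tendsto _ _ (ckTopology I N k) _ _
    (continuous_iteratedFDeriv_ckTopology I N k p 0) f).comp hF
  have h2 := UniformOnFun.tendsto_iff_tendstoUniformlyOn.1 h1 K ⟨hKc, hKt⟩
  refine ⟨(extChartAt I p).source ∩ extChartAt I p ⁻¹' K, ?_, ?_⟩
  · rw [nhdsWithin_univ]
    exact Filter.inter_mem (extChartAt_source_mem_nhds p) ((continuousAt_extChartAt p) hK)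
  · rw [Metric.tendstoUniformlyOn_iff] at h2 ⊢
    intro ε hε
    filter_upwards [h2 ε hε] with a ha x hx
    have h3 : dist (iteratedFDeriv ℝ 0 (f ∘ (extChartAt I p).symm) (extChartAt I p x))
      (iteratedFDeriv ℝ 0 (F a ∘ (extChartAt I p).symm) (extChartAt I p x)) < ε := ha _ hx.2
    rw [iteratedFDeriv_zero_eq_comp, iteratedFDeriv_zero_eq_comp] at h3
    have h4 := (continuousMultilinearCurryFin0 ℝ E ℝ).symm.dist_map
      ((f ∘ (extChartAt I p).symm) (extChartAt I p x))
      ((F a ∘ (extChartAt I p).symm) (extChartAt I p x))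
    have h5 := h4.symm.trans_lt h3
    rwa [Function.comp_apply, Function.comp_apply, (extChartAt I p).left_inv hx.1] at h5

/-- The functions `f + ∑ t_i Φ_i` depend continuously on `t` in the topology of `C^k`
convergence. -/
theorem continuous_add_sum_smul_ckTopology [I.Boundaryless] [IsManifold I k N]
    {ι : Type*} [Fintype ι] {f : N → ℝ} {Φ : ι → N → ℝ} (hf : ContMDiff I 𝓘(ℝ, ℝ) k f)
    (hΦ : ∀ i, ContMDiff I 𝓘(ℝ, ℝ) k (Φ i)) :
    Continuous[inferInstance, ckTopology I N k] fun t : ι → ℝ => f + ∑ i, t i • Φ i := by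
  refine continuous_iInf_rng.2 fun p => continuous_iInf_rng.2 fun j => continuous_induced_rng.2 ?_
  have hjk : ((j : ℕ) : WithTop ℕ∞) ≤ k := by exact_mod_cast Nat.lt_succ_iff.1 j.2
  have hopen := isOpen_extChartAt_target (I := I) p
  have hcd : ∀ u : N → ℝ, ContMDiff I 𝓘(ℝ, ℝ) k u →
      ContDiffOn ℝ j (u ∘ (extChartAt I p).symm) (extChartAt I p).target := fun u hu =>
    (contMDiffOn_iff_contDiffOn.1
      (hu.comp_contMDiffOn (contMDiffOn_extChartAt_symm p))).of_le hjk
  have hco : ∀ u : N → ℝ, ContMDiff I 𝓘(ℝ, ℝ) k u →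
      ContinuousOn (iteratedFDeriv ℝ j (u ∘ (extChartAt I p).symm)) (extChartAt I p).target :=
    fun u hu => ((hcd u hu).continuousOn_iteratedFDerivWithin le_rfl hopen.uniqueDiffOn).congr
      fun y hy => (iteratedFDerivWithin_of_isOpen _ hopen hy).symm
  have hat : ∀ u : N → ℝ, ContMDiff I 𝓘(ℝ, ℝ) k u → ∀ y ∈ (extChartAt I p).target,
      ContDiffAt ℝ j (u ∘ (extChartAt I p).symm) y := fun u hu y hy =>
    (hcd u hu).contDiffAt (hopen.mem_nhds hy)
  have hform : ∀ t : ι → ℝ, ∀ y ∈ (extChartAt I p).target,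
      iteratedFDeriv ℝ j ((f + ∑ i, t i • Φ i) ∘ (extChartAt I p).symm) y =
        iteratedFDeriv ℝ j (f ∘ (extChartAt I p).symm) y +
          ∑ i, t i • iteratedFDeriv ℝ j (Φ i ∘ (extChartAt I p).symm) y := by
    intro t y hy
    have e : (f + ∑ i, t i • Φ i) ∘ (extChartAt I p).symm = f ∘ (extChartAt I p).symm +
        ∑ i, t i • (Φ i ∘ (extChartAt I p).symm) := by
      ext z; simp
    have hs : ∀ i ∈ Finset.univ, ContDiffAt ℝ j (t i • (Φ i ∘ (extChartAt I p).symm)) y :=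
      fun i _ => (hat _ (hΦ i) y hy).const_smul (t i)
    rw [e, iteratedFDeriv_add_apply (hat f hf y hy), iteratedFDeriv_sum_apply hs]
    · congr 1
      exact Finset.sum_congr rfl fun i _ => iteratedFDeriv_const_smul_apply (hat _ (hΦ i) y hy)
    · have := ContDiffAt.sum hs
      convert this using 1
      ext z
      simp
  refine continuous_iff_continuousAt.2 fun t₀ => ?_
  refine UniformOnFun.tendsto_iff_tendstoUniformlyOn.2 fun K hK => ?_
  -- The derivative is affine in `t` with coefficients continuous in `y`; joint continuity and
  -- compactness of `K` make the convergence uniform on `K`.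
  have hunif : ContinuousOn (fun q : (ι → ℝ) × E =>
      iteratedFDeriv ℝ j ((f + ∑ i, q.1 i • Φ i) ∘ (extChartAt I p).symm) q.2) (univ ×ˢ K) := by
    have hsnd : ∀ u : N → ℝ, ContMDiff I 𝓘(ℝ, ℝ) k u → ContinuousOn (fun q : (ι → ℝ) × E =>
        iteratedFDeriv ℝ j (u ∘ (extChartAt I p).symm) q.2) (univ ×ˢ K) := fun u hu =>
      (hco u hu).comp continuousOn_snd fun q hq => hK.2 hq.2
    refine ContinuousOn.congr ?_ fun q hq => hform q.1 q.2 (hK.2 hq.2)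
    refine (hsnd f hf).add (continuousOn_finsetSum _ fun i _ => ?_)
    exact ((continuous_apply i).comp continuous_fst).continuousOn.smul (hsnd _ (hΦ i))
  intro u hu
  obtain ⟨v, hv, hvu⟩ := hK.1.mem_uniformity_of_prod (f := fun (t : ι → ℝ) y =>
    iteratedFDeriv ℝ j ((f + ∑ i, t i • Φ i) ∘ (extChartAt I p).symm) y) hunif
    (mem_univ t₀) (symm_le_uniformity hu)
  rw [nhdsWithin_univ] at hv
  filter_upwards [hv] with t ht y hy using hvu t ht y hy

end CkTopology

/-! ### Perturbing symmetric `C^k` potentials by smooth external fields -/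

section Manifold

variable {d k : ℕ} {M : Type*} [TopologicalSpace M] [ChartedSpace (Coord d) M]

/-- An element of `C^k_sym(M × M)` as a continuous function. -/
def CkSym.toContinuousMap (V : CkSym d k M) : C(M × M, ℝ) := ⟨V.1, V.2.1.continuous⟩

theorem CkSym.continuous_val : Continuous[instTopologicalSpaceCkSym d k M,
    ckTopology ((𝓡 d).prod (𝓡 d)) (M × M) k] fun V : CkSym d k M => V.1 :=
  continuous_induced_dom

theorem CkSym.continuous_toContinuousMap [CompactSpace M] :
    Continuous (CkSym.toContinuousMap : CkSym d k M → C(M × M, ℝ)) := by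
  refine continuous_iff_continuousAt.2 fun V => ?_
  refine ContinuousMap.tendsto_iff_tendstoLocallyUniformly.2 ?_
  refine tendstoLocallyUniformly_of_tendsto_ckTopology (I := (𝓡 d).prod (𝓡 d)) (k := k) ?_
  exact @Continuous.tendsto _ _ _ (ckTopology ((𝓡 d).prod (𝓡 d)) (M × M) k) _
    CkSym.continuous_val V

theorem contMDiff_field (a : C^∞⟮𝓡 d, M; ℝ⟯) :
    ContMDiff ((𝓡 d).prod (𝓡 d)) 𝓘(ℝ, ℝ) k fun q : M × M => a q.1 + a q.2 :=
  ((a.contMDiff.comp contMDiff_fst).add (a.contMDiff.comp contMDiff_snd)).of_le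
    (by exact_mod_cast le_top)

/-- The potential `V(x, y) + ∑ t_i (φ_i(x) + φ_i(y))`. -/
def CkSym.addField (V : CkSym d k M) {ι : Type*} [Fintype ι] (φ : ι → C^∞⟮𝓡 d, M; ℝ⟯)
    (t : ι → ℝ) : CkSym d k M :=
  ⟨V.1 + ∑ i, t i • fun q : M × M => φ i q.1 + φ i q.2,
    V.2.1.add (contMDiff_finsetSum' fun i _ =>
      (contMDiff_const (c := t i)).mul (contMDiff_field (φ i))),
    fun x y => by simp [V.2.2 x y, add_comm]⟩

theorem CkSym.toContinuousMap_addField [CompactSpace M] (V : CkSym d k M) {ι : Type*} [Fintype ι]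
    (φ : ι → C^∞⟮𝓡 d, M; ℝ⟯) (t : ι → ℝ) : (V.addField φ t).toContinuousMap =
      V.toContinuousMap + fieldKernel (∑ i, t i • (φ i : C(M, ℝ))) := by
  ext q
  simp [CkSym.addField, CkSym.toContinuousMap, fieldKernel, mul_add, Finset.sum_add_distrib]

variable [IsManifold (𝓡 d) ∞ M]

theorem CkSym.continuous_addField (V : CkSym d k M) {ι : Type*} [Fintype ι]
    (φ : ι → C^∞⟮𝓡 d, M; ℝ⟯) : Continuous (V.addField φ) := by
  have : IsManifold ((𝓡 d).prod (𝓡 d)) (k : WithTop ℕ∞) (M × M) :=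
    IsManifold.of_le (n := ∞) (by exact_mod_cast le_top)
  exact continuous_induced_rng.2
    (continuous_add_sum_smul_ckTopology V.2.1 fun i => contMDiff_field (φ i))

/-- A continuous kernel is uniformly approximated by finite-rank kernels that are smooth in the
first variable. -/
theorem exists_finiteRank_approx [T2Space M] [CompactSpace M] (V : C(M × M, ℝ)) {ε : ℝ}
    (hε : 0 < ε) : ∃ (s : Finset M) (φ : s → C^∞⟮𝓡 d, M; ℝ⟯),
      ∀ x y, |V (x, y) - ∑ i, φ i x * V (i, y)| ≤ ε := by
  -- Closeness is measured in the sup norm of `V(x, ·)`, so the approximation is uniform in `y`.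
  let U : M → Set M := fun z => {x | dist (V.curry x) (V.curry z) < ε}
  have hUo : ∀ z, IsOpen (U z) := fun z =>
    isOpen_lt (V.curry.continuous.dist continuous_const) continuous_const
  obtain ⟨s, hs⟩ := isCompact_univ.elim_finite_subcover U hUo fun x _ =>
    mem_iUnion.2 ⟨x, by simpa [U] using hε⟩
  obtain ⟨ρ, hρ⟩ := SmoothPartitionOfUnity.exists_isSubordinate (𝓡 d) isClosed_univ
    (fun i : s => U i) (fun i => hUo i) (by simpa [iUnion_subtype] using hs)
  refine ⟨s, ρ, fun x y => ?_⟩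
  have h1 : ∑ i, ρ i x = 1 := by
    rw [← finsum_eq_sum_of_fintype]; exact ρ.sum_eq_one (mem_univ x)
  have h2 : V (x, y) - ∑ i, ρ i x * V (i, y) = ∑ i, ρ i x * (V (x, y) - V (i, y)) := by
    simp_rw [mul_sub]
    rw [Finset.sum_sub_distrib, ← Finset.sum_mul, h1, one_mul]
  rw [h2]
  calc |∑ i, ρ i x * (V (x, y) - V (i, y))| ≤ ∑ i, |ρ i x * (V (x, y) - V (i, y))| :=
        Finset.abs_sum_le_sum_abs _ _
    _ ≤ ∑ i, ρ i x * ε := by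
        refine Finset.sum_le_sum fun i _ => ?_
        rw [abs_mul, abs_of_nonneg (ρ.nonneg i x)]
        by_cases hx : ρ i x = 0
        · simp [hx]
        · refine mul_le_mul_of_nonneg_left ?_ (ρ.nonneg i x)
          have hxU : x ∈ U i := hρ i (subset_tsupport _ hx)
          have := (ContinuousMap.dist_apply_le_dist (f := V.curry x) (g := V.curry i) y)
          rw [Real.dist_eq] at this
          exact this.trans (le_of_lt hxU)
    _ = ε := by rw [← Finset.sum_mul, h1, one_mul]

/-- For every Borel probability `λ`, the potentials all of whose fixed points are nondegenerate form
an open and dense subset of `C^k_sym(M × M)`. -/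
theorem isOpen_and_dense_nondegenerate [T2Space M] [CompactSpace M] [MeasurableSpace M]
    [BorelSpace M] (lam : Measure M) [IsProbabilityMeasure lam] :
    IsOpen {V : CkSym d k M | ∀ μ ∈ fixedPoints lam V.1, IsNondegenerate lam V.1 μ} ∧
      Dense {V : CkSym d k M | ∀ μ ∈ fixedPoints lam V.1, IsNondegenerate lam V.1 μ} := by
  have hset : {V : CkSym d k M | ∀ μ ∈ fixedPoints lam V.1, IsNondegenerate lam V.1 μ} =
      CkSym.toContinuousMap ⁻¹' {V | IsRegularKernel lam V} := by
    ext V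
    exact forall_isNondegenerate_iff lam V.toContinuousMap
  rw [hset]
  refine ⟨(isOpen_isRegularKernel lam).preimage CkSym.continuous_toContinuousMap, fun V => ?_⟩
  obtain ⟨s, φ, hφ⟩ := exists_finiteRank_approx (d := d) V.toContinuousMap
    (ε := 1 / 4) (by norm_num)
  have hae := ae_isRegularKernel lam V.toContinuousMap (fun i => (φ i : C(M, ℝ)))
    (fun i => V.toContinuousMap.curry i) hφ
  -- A full-measure set of parameters is dense, so good `t` accumulate at `0`, where the perturbed
  -- potential is `V`.
  have hmem := (Measure.dense_of_ae hae) 0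
  have h0 : V.addField φ 0 = V := Subtype.ext (by simp [CkSym.addField])
  rw [← h0]
  refine map_mem_closure (V.continuous_addField φ) hmem fun t ht => ?_
  rw [mem_preimage, CkSym.toContinuousMap_addField]
  exact ht

end Manifold

/-! ### The Riemannian probability is a probability measure -/

section GramMatrix

variable {d : ℕ} {M : Type*} [TopologicalSpace M] [ChartedSpace (Coord d) M]
  [IsManifold (𝓡 d) ∞ M]

theorem mfderiv_extChartAt_symm_injective (p : M) {y : Coord d}
    (hy : y ∈ (extChartAt (𝓡 d) p).target) :
    Function.Injective (mfderiv 𝓘(ℝ, Coord d) (𝓡 d) (extChartAt (𝓡 d) p).symm y) := by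
  have : IsManifold (𝓡 d) 1 M := IsManifold.of_le (n := ∞) (by exact_mod_cast le_top)
  have h := mfderiv_extChartAt_comp_mfderivWithin_extChartAt_symm (I := 𝓡 d) hy
  rw [ModelWithCorners.Boundaryless.range_eq_univ, mfderivWithin_univ] at h
  exact Function.LeftInverse.injective fun v => DFunLike.congr_fun h v

theorem continuousOn_coordVector (p : M) (i : Fin d) :
    ContinuousOn (fun y => (⟨(extChartAt (𝓡 d) p).symm y, coordVector p y i⟩ :
      TangentBundle (𝓡 d) M)) (extChartAt (𝓡 d) p).target := by
  have : IsManifold (𝓡 d) 1 M := IsManifold.of_le (n := ∞) (by exact_mod_cast le_top)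
  have hopen := isOpen_extChartAt_target (I := 𝓡 d) p
  have h := (contMDiffOn_extChartAt_symm (I := 𝓡 d) (n := 1) p).continuousOn_tangentMapWithin
    le_rfl hopen.uniqueMDiffOn
  have hc : Continuous fun y : Coord d =>
      (⟨y, (EuclideanSpace.single i (1 : ℝ) : Coord d)⟩ : TangentBundle 𝓘(ℝ, Coord d) (Coord d)) :=
    (tangentBundleModelSpaceHomeomorph 𝓘(ℝ, Coord d)).symm.continuous.comp
      (continuous_id.prodMk continuous_const)
  refine (h.comp hc.continuousOn fun y hy => hy).congr fun y hy => ?_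
  simp only [Function.comp_apply, tangentMapWithin, coordVector]
  rw [mfderivWithin_of_isOpen hopen hy]

theorem continuousOn_gramMatrix (g : SmoothMetric d M) (p : M) :
    ContinuousOn (gramMatrix g p) (extChartAt (𝓡 d) p).target := by
  refine continuousOn_pi.2 fun i => continuousOn_pi.2 fun j => ?_
  intro y hy
  have hg : ContinuousWithinAt (fun z => Bundle.TotalSpace.mk' (Coord d →L[ℝ] Coord d →L[ℝ] ℝ)
      (E := fun x : M => TangentSpace (𝓡 d) x →L[ℝ] TangentSpace (𝓡 d) x →L[ℝ] ℝ)
      ((extChartAt (𝓡 d) p).symm z) (g.inner ((extChartAt (𝓡 d) p).symm z)))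
      (extChartAt (𝓡 d) p).target y :=
    g.contMDiff.continuous.continuousAt.comp_continuousWithinAt
      (continuousOn_extChartAt_symm p y hy)
  have h := hg.clm_bundle_apply₂ (F₃ := ℝ) (E₃ := Bundle.Trivial M ℝ) (F₁ := Coord d)
    (F₂ := Coord d) (continuousOn_coordVector p i y hy) (continuousOn_coordVector p j y hy)
  simp only [FiberBundle.continuousWithinAt_totalSpace] at h
  exact h.2

/-- The quadratic form of the Gram matrix is `g(Aw, Aw)`, where `A` is the injective differential of
the inverse chart. -/
theorem posDef_gramMatrix (g : SmoothMetric d M) (p : M) {y : Coord d}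
    (hy : y ∈ (extChartAt (𝓡 d) p).target) : (gramMatrix g p y).PosDef := by
  refine Matrix.PosDef.of_dotProduct_mulVec_pos ?_ fun x hx => ?_
  · ext i j
    exact g.symm _ _ _
  · set A := mfderiv 𝓘(ℝ, Coord d) (𝓡 d) (extChartAt (𝓡 d) p).symm y with hA
    let w : Coord d := WithLp.toLp 2 x
    have hw : w = ∑ i, x i • (EuclideanSpace.single i (1 : ℝ) : Coord d) := by
      ext j
      simp [w, Pi.single_apply]
    have hAw : A w = ∑ i, x i • coordVector p y i := by
      rw [hw]
      exact (map_sum A _ _).trans (Finset.sum_congr rfl fun i _ => map_smul A _ _)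
    have hAw0 : A w ≠ 0 := by
      intro h0
      have : w = 0 := mfderiv_extChartAt_symm_injective p hy (h0.trans (map_zero A).symm)
      exact hx (congrArg WithLp.ofLp this)
    have hpos := g.pos _ _ hAw0
    have e : star x ⬝ᵥ Matrix.mulVec (gramMatrix g p y) x =
        g.inner ((extChartAt (𝓡 d) p).symm y) (A w) (A w) := by
      rw [hAw]
      simp only [map_sum, map_smul, sum_apply, smul_apply,
        smul_eq_mul, dotProduct, Matrix.mulVec, gramMatrix, Matrix.of_apply, star_trivial,
        Finset.mul_sum]
      rw [Finset.sum_comm]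
      refine Finset.sum_congr rfl fun i _ => Finset.sum_congr rfl fun j _ => ?_
      ring
    rwa [e]

end GramMatrix

/-! ### Finiteness and positivity of the total volume -/

section RiemannianProbability

variable {d : ℕ} {M : Type*} [TopologicalSpace M] [ChartedSpace (Coord d) M]
  [IsManifold (𝓡 d) ∞ M] [T2Space M] [CompactSpace M]

/-- The density of the part of the Riemannian volume carried by the chart around `p`. -/
def chartDensity (g : SmoothMetric d M) (p : M) (y : Coord d) : ℝ :=
  chartPartition d M p ((extChartAt (𝓡 d) p).symm y) * Real.sqrt (gramMatrix g p y).det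

theorem continuousOn_chartDensity (g : SmoothMetric d M) (p : M) :
    ContinuousOn (chartDensity g p) (extChartAt (𝓡 d) p).target :=
  ((chartPartition d M p).contMDiff.continuous.comp_continuousOn
    (continuousOn_extChartAt_symm p)).mul
    (Real.continuous_sqrt.comp_continuousOn
      ((continuous_id.matrix_det).comp_continuousOn (continuousOn_gramMatrix g p)))

/-- The density is continuous on the chart target and vanishes there off the compact image of the
support of the partition function. -/
theorem lintegral_chartDensity_lt_top (g : SmoothMetric d M) (p : M) :
    ∫⁻ y in (extChartAt (𝓡 d) p).target, ENNReal.ofReal (chartDensity g p y) < ⊤ := by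
  let K := extChartAt (𝓡 d) p '' tsupport (chartPartition d M p)
  have hsub : tsupport (chartPartition d M p) ⊆ (extChartAt (𝓡 d) p).source := by
    rw [extChartAt_source]
    exact (SmoothPartitionOfUnity.exists_isSubordinate_chartAt_source (𝓡 d) M).choose_spec p
  have hK : IsCompact K := (isClosed_tsupport _).isCompact.image_of_continuousOn
    ((continuousOn_extChartAt p).mono hsub)
  have hKt : K ⊆ (extChartAt (𝓡 d) p).target := by
    rintro _ ⟨x, hx, rfl⟩
    exact (extChartAt (𝓡 d) p).map_source (hsub hx)
  obtain ⟨C, hC⟩ := hK.bddAbove_image ((continuousOn_chartDensity g p).mono hKt)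
  have hle : ∀ y ∈ (extChartAt (𝓡 d) p).target,
      ENNReal.ofReal (chartDensity g p y) ≤ K.indicator (fun _ => ENNReal.ofReal C) y := by
    intro y hy
    by_cases hyK : y ∈ K
    · rw [indicator_of_mem hyK]
      exact ENNReal.ofReal_le_ofReal (hC ⟨y, hyK, rfl⟩)
    · have : chartPartition d M p ((extChartAt (𝓡 d) p).symm y) = 0 := by
        by_contra hne
        exact hyK ⟨_, subset_tsupport _ hne, (extChartAt (𝓡 d) p).right_inv hy⟩
      rw [chartDensity, this, zero_mul, ENNReal.ofReal_zero]
      exact zero_le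
  calc ∫⁻ y in (extChartAt (𝓡 d) p).target, ENNReal.ofReal (chartDensity g p y)
      ≤ ∫⁻ y in (extChartAt (𝓡 d) p).target, K.indicator (fun _ => ENNReal.ofReal C) y :=
        setLIntegral_mono' (isOpen_extChartAt_target p).measurableSet hle
    _ ≤ ∫⁻ y, K.indicator (fun _ => ENNReal.ofReal C) y := setLIntegral_le_lintegral _ _
    _ = ENNReal.ofReal C * volume K := lintegral_indicator_const hK.measurableSet _
    _ < ⊤ := ENNReal.mul_lt_top ENNReal.ofReal_lt_top hK.measure_lt_top

theorem lintegral_chartDensity_pos (g : SmoothMetric d M) {p x : M}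
    (hx : chartPartition d M p x ≠ 0) :
    0 < ∫⁻ y in (extChartAt (𝓡 d) p).target, ENNReal.ofReal (chartDensity g p y) := by
  have hsub : tsupport (chartPartition d M p) ⊆ (extChartAt (𝓡 d) p).source := by
    rw [extChartAt_source]
    exact (SmoothPartitionOfUnity.exists_isSubordinate_chartAt_source (𝓡 d) M).choose_spec p
  have hxs : x ∈ (extChartAt (𝓡 d) p).source := hsub (subset_tsupport _ hx)
  have hopen := isOpen_extChartAt_target (I := 𝓡 d) p
  set y₀ := extChartAt (𝓡 d) p x
  have hy₀ : y₀ ∈ (extChartAt (𝓡 d) p).target := (extChartAt (𝓡 d) p).map_source hxs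
  have hpos : 0 < chartDensity g p y₀ := by
    refine mul_pos ?_ (Real.sqrt_pos.2 (posDef_gramMatrix g p hy₀).det_pos)
    rw [(extChartAt (𝓡 d) p).left_inv hxs]
    exact ((chartPartition d M).nonneg p x).lt_of_ne' hx
  obtain ⟨c, hc0, hc⟩ := exists_between hpos
  have hU : IsOpen ((extChartAt (𝓡 d) p).target ∩ chartDensity g p ⁻¹' Ioi c) :=
    (continuousOn_chartDensity g p).isOpen_inter_preimage hopen isOpen_Ioi
  set U := (extChartAt (𝓡 d) p).target ∩ chartDensity g p ⁻¹' Ioi c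
  calc 0 < ENNReal.ofReal c * volume U :=
        ENNReal.mul_pos (ENNReal.ofReal_pos.2 hc0).ne' (hU.measure_pos volume ⟨y₀, hy₀, hc⟩).ne'
    _ = ∫⁻ _ in U, ENNReal.ofReal c := (setLIntegral_const U _).symm
    _ ≤ ∫⁻ y in U, ENNReal.ofReal (chartDensity g p y) :=
        setLIntegral_mono' hU.measurableSet fun y hy => ENNReal.ofReal_le_ofReal (le_of_lt hy.2)
    _ ≤ _ := lintegral_mono_set inter_subset_left

variable [MeasurableSpace M] [BorelSpace M]

theorem riemannianVolume_univ (g : SmoothMetric d M) : riemannianVolume g univ =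
    ∑' p : M, ∫⁻ y in (extChartAt (𝓡 d) p).target, ENNReal.ofReal (chartDensity g p y) := by
  rw [riemannianVolume, Measure.sum_apply _ MeasurableSet.univ]
  refine tsum_congr fun p => ?_
  -- The inverse chart is continuous only on the target, which carries all the mass.
  have hm : AEMeasurable (extChartAt (𝓡 d) p).symm
      (((volume : Measure (Coord d)).restrict (extChartAt (𝓡 d) p).target).withDensity
        fun y => ENNReal.ofReal (chartDensity g p y)) :=
    ((continuousOn_extChartAt_symm p).aemeasurable
      (isOpen_extChartAt_target p).measurableSet).mono_ac (withDensity_absolutelyContinuous _ _)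
  refine (Measure.map_apply_of_aemeasurable hm MeasurableSet.univ).trans ?_
  rw [preimage_univ, withDensity_apply _ MeasurableSet.univ, setLIntegral_univ]

theorem isProbabilityMeasure_riemannianProbability [Nonempty M] (g : SmoothMetric d M) :
    IsProbabilityMeasure (riemannianProbability g) := by
  -- By compactness and local finiteness, all but finitely many terms of the sum over `p : M`
  -- vanish.
  have hfin : {p : M | (Function.support (chartPartition d M p)).Nonempty}.Finite :=
    (chartPartition d M).locallyFinite.finite_nonempty_of_compact
  have htop : riemannianVolume g univ ≠ ⊤ := by
    rw [riemannianVolume_univ, tsum_eq_sum (s := hfin.toFinset)]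
    · exact (ENNReal.sum_lt_top.2 fun p _ => lintegral_chartDensity_lt_top g p).ne
    · intro p hp
      have h0 : ∀ x, chartPartition d M p x = 0 := by
        intro x
        by_contra hx
        exact hp (hfin.mem_toFinset.2 ⟨x, hx⟩)
      simp [chartDensity, h0]
  have hzero : riemannianVolume g univ ≠ 0 := by
    obtain ⟨x⟩ := ‹Nonempty M›
    obtain ⟨p, hp⟩ : ∃ p, chartPartition d M p x ≠ 0 := by
      by_contra! h
      have := (chartPartition d M).sum_eq_one (mem_univ x)
      simp [h] at this
    rw [riemannianVolume_univ]
    exact ((lintegral_chartDensity_pos g hp).trans_le (ENNReal.le_tsum p)).ne'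
  exact ⟨by rw [riemannianProbability, Measure.smul_apply, smul_eq_mul,
    ENNReal.inv_mul_cancel hzero htop]⟩

end RiemannianProbability

end SelfInteracting
end

theorem mainTheorem5 {d : ℕ} {M : Type*} [TopologicalSpace M] [T2Space M] [CompactSpace M]
    [ConnectedSpace M] [ChartedSpace (SelfInteracting.Coord d) M] [IsManifold (𝓡 d) ∞ M]
    [MeasurableSpace M] [BorelSpace M] (g : SelfInteracting.SmoothMetric d M) (k : ℕ) :
    IsOpen (SelfInteracting.nondegeneratePotentials k g) ∧
      Dense (SelfInteracting.nondegeneratePotentials k g) := by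
  have := SelfInteracting.isProbabilityMeasure_riemannianProbability g
  exact SelfInteracting.isOpen_and_dense_nondegenerate _
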